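/- Let $M_1$ and $M_2$ be transitive models of $\mathrm{ZF}$ (sets or proper classes, with the true membership relation) having the same ordinals, $M_1\cap\mathrm{OR}=M_2\cap\mathrm{OR}$, and let $N$ be any model of $\mathrm{ZF}$ (for instance a transitive one). Suppose that $j_1\colon M_1\to N$ and $j_2\colon M_2\to N$ are elementary embeddings in the language $\{\in\}$ with $j_1(\alpha)=j_2(\alpha)$ for every ordinal $\alpha\in M_1\cap\mathrm{OR}$. Then $\mathrm{HOD}^{M_1}=\mathrm{HOD}^{M_2}$, and $j_1(x)=j_2(x)$ for every $x\in\mathrm{HOD}^{M_1}$. Here $\mathrm{HOD}^{M}$ is the class of all $x\in M$ such that $M\models$ "$x$ is hereditarily ordinal definable", that is, $M\models$ "every element of the transitive closure of $\{x\}$ is ordinal definable", where $y$ is ordinal definable if for some ordinal $\beta$ the set $y\in V_\beta$ is definable in the structure $(V_\beta,\in)$ by a first-order formula with finitely many ordinals less than $\beta$ as parameters. -/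

import Mathlib

open FirstOrder

universe u w

namespace SetModel

/-- The relation symbols of the language of set theory: one binary symbol. -/
inductive MemRel : ℕ → Type
  | mem : MemRel 2

/-- The first-order language `{∈}` of set theory (equality is logical). -/
def setLang : FirstOrder.Language.{0, 0} := ⟨fun _ => Empty, MemRel⟩

/-- A class `M` of sets, as the structure `(M, ∈)`. -/
instance classStructure (M : Set ZFSet.{u}) : setLang.Structure M where
  funMap := fun f _ => Empty.elim f
  RelMap := fun {_} r => match r with
    | MemRel.mem => fun v => (v 0 : ZFSet.{u}) ∈ (v 1 : ZFSet.{u})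

/- Everything in this section speaks about an arbitrary structure `M` for the language `{∈}`. All
quantifiers range over `M`, so that each predicate is the relativization to `M` of the usual
set-theoretic formula. -/
section Formulas

variable {M : Type w} [setLang.Structure M]

/-- The membership relation of the structure. -/
def Mem (x y : M) : Prop :=
  Language.Structure.RelMap (L := setLang) MemRel.mem ![x, y]

local infix:50 " ε " => Mem

/-- `a ⊆ b`. -/
def Sub (a b : M) : Prop := ∀ z : M, z ε a → z ε b

/-- `a = ∅`. -/
def IsZero (a : M) : Prop := ∀ z : M, ¬ z ε a

/-- `s = a ∪ {a}`. -/
def IsSucc (a s : M) : Prop := ∀ z : M, z ε s ↔ z ε a ∨ z = a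

/-- `c = {a, b}`. -/
def IsPair (a b c : M) : Prop := ∀ z : M, z ε c ↔ z = a ∨ z = b

/-- `c = (a, b) = {{a}, {a, b}}`. -/
def IsOPair (a b c : M) : Prop := ∃ d e : M, IsPair a a d ∧ IsPair a b e ∧ IsPair d e c

/-- `a` is a transitive set. -/
def IsTrans (a : M) : Prop := ∀ y : M, y ε a → Sub y a

/-- `a` is an ordinal: a transitive set of transitive sets. -/
def IsOrd (a : M) : Prop := IsTrans a ∧ ∀ y : M, y ε a → IsTrans y

/-- `n` is a natural number: an ordinal such that every ordinal `≤ n` is zero or a successor. -/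
def IsNat (n : M) : Prop :=
  IsOrd n ∧ ∀ k : M, (k ε n ∨ k = n) → (IsZero k ∨ ∃ m : M, IsSucc m k)

/-- The pair `(x, y)` belongs to `f`; for a function `f`, this says `f(x) = y`. -/
def App (f x y : M) : Prop := ∃ p : M, IsOPair x y p ∧ p ε f

/-- `f` is a function with domain `d`. -/
def IsFunOn (f d : M) : Prop :=
  (∀ p : M, p ε f → ∃ x y : M, x ε d ∧ IsOPair x y p) ∧
    ∀ x : M, x ε d → ∃! y : M, App f x y

/-- `f` is a function from `d` to `a`. -/
def IsFunTo (f d a : M) : Prop := IsFunOn f d ∧ ∀ x y : M, App f x y → y ε a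

/-- `A = V_β`, the stage `β` of the cumulative hierarchy: there is a function `h` on `β + 1` with
`h(α) = ⋃_{γ < α} 𝒫(h(γ))` for all `α ≤ β` and `h(β) = A`. -/
def IsVStage (β A : M) : Prop :=
  ∃ s h : M, IsSucc β s ∧ IsFunOn h s ∧
    (∀ α y : M, α ε s → App h α y →
      ∀ z : M, z ε y ↔ ∃ γ v : M, γ ε α ∧ App h γ v ∧ Sub z v) ∧
    App h β A

/-! Formulas of the language `{∈}` in the variables `v_i`, `i < n`, are coded by sets:
`(0, (i, j))` is `v_i = v_j`, `(1, (i, j))` is `v_i ∈ v_j`, `(2, (φ, φ))` is `¬ φ`,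
`(3, (φ, ψ))` is `φ ∧ ψ`, and `(4, (i, φ))` is `∃ v_i, φ`. -/

/-- `a` is the numeral `k`. -/
def IsNumeral : ℕ → M → Prop
  | 0, a => IsZero a
  | k + 1, a => ∃ b : M, IsNumeral k b ∧ IsSucc b a

/-- `c = (k, (a, b))`. -/
def IsCode (k : ℕ) (a b c : M) : Prop :=
  ∃ t p : M, IsNumeral k t ∧ IsOPair a b p ∧ IsOPair t p c

/-- For functions `p`, `q` on `n`: `q` is the function that takes the value `y` at `i` and agrees
with `p` on the rest of `n`. -/
def IsUpdate (n p i y q : M) : Prop :=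
  IsFunOn q n ∧ App q i y ∧ ∀ k z : M, k ε n → k ≠ i → (App q k z ↔ App p k z)

/-- `S` is a satisfaction function for the structure `(A, ∈)` on a set `D` of (codes of) formulas
in the variables `v_i`, `i < n`. Here `D` is closed under immediate subformulas, the domain of `S`
is `D`, and `S(c)` is, by Tarski's clauses, the set of the assignments `q : n → A` that satisfy
the formula `c` in `(A, ∈)`. -/
def IsSat (A n D S : M) : Prop :=
  IsFunOn S D ∧ ∀ c T : M, c ε D → App S c T →
    -- `c` is `v_i = v_j`
    ((∃ i j : M, i ε n ∧ j ε n ∧ IsCode 0 i j c ∧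
        ∀ q : M, q ε T ↔ IsFunTo q n A ∧ ∃ a : M, App q i a ∧ App q j a) ∨
    -- `c` is `v_i ∈ v_j`
     (∃ i j : M, i ε n ∧ j ε n ∧ IsCode 1 i j c ∧
        ∀ q : M, q ε T ↔ IsFunTo q n A ∧ ∃ a b : M, App q i a ∧ App q j b ∧ a ε b) ∨
    -- `c` is `¬ φ`
     (∃ φ U : M, φ ε D ∧ App S φ U ∧ IsCode 2 φ φ c ∧
        ∀ q : M, q ε T ↔ IsFunTo q n A ∧ ¬ q ε U) ∨
    -- `c` is `φ ∧ ψ`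
     (∃ φ ψ U W : M, φ ε D ∧ ψ ε D ∧ App S φ U ∧ App S ψ W ∧ IsCode 3 φ ψ c ∧
        ∀ q : M, q ε T ↔ IsFunTo q n A ∧ q ε U ∧ q ε W) ∨
    -- `c` is `∃ v_i, φ`
     (∃ i φ U : M, i ε n ∧ φ ε D ∧ App S φ U ∧ IsCode 4 i φ c ∧
        ∀ q : M, q ε T ↔ IsFunTo q n A ∧
          ∃ a r : M, a ε A ∧ IsUpdate n q i a r ∧ r ε U))

/-- `x` is ordinal definable: there are an ordinal `β`, a formula `c` in variables `v_i`, `i < n`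
(where `0 < n`), and ordinals `p(i) < β`, such that `x` is the unique `y ∈ V_β` for which `(V_β, ∈)`
satisfies `c` under `v_0 ↦ y` and `v_i ↦ p(i)` for `0 < i < n`. The value `p(0)` is not used. -/
def IsOD (x : M) : Prop :=
  ∃ β A n o D S c T p : M,
    IsOrd β ∧ IsVStage β A ∧ IsNat n ∧ IsZero o ∧ o ε n ∧
    IsSat A n D S ∧ c ε D ∧ App S c T ∧ IsFunTo p n β ∧ x ε A ∧
    ∀ y : M, y ε A → ((∃ q : M, IsUpdate n p o y q ∧ q ε T) ↔ y = x)

/-- `x` is hereditarily ordinal definable: the transitive closure of `{x}` consists of ordinal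
definable sets, that is, `x` belongs to a transitive set of ordinal definable sets. -/
def IsHOD (x : M) : Prop :=
  ∃ t : M, IsTrans t ∧ x ε t ∧ ∀ y : M, y ε t → IsOD y

variable (M)

/-- The structure `M` is a model of `ZF`. In the two schemes, a class given by a formula with
parameters is a set `P` (or a relation `F`) that is first-order definable over `M` in the
language `{∈}` with parameters from `M`. -/
structure IsModelZF : Prop where
  extensionality : ∀ a b : M, (∀ z : M, z ε a ↔ z ε b) → a = b
  foundation : ∀ a : M, (∃ z : M, z ε a) → ∃ z : M, z ε a ∧ ∀ y : M, y ε z → ¬ y ε a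
  pairing : ∀ a b : M, ∃ c : M, IsPair a b c
  union : ∀ a : M, ∃ b : M, ∀ z : M, z ε b ↔ ∃ y : M, y ε a ∧ z ε y
  powerset : ∀ a : M, ∃ b : M, ∀ z : M, z ε b ↔ Sub z a
  infinity : ∃ a : M, (∃ z : M, IsZero z ∧ z ε a) ∧
    ∀ n : M, n ε a → ∃ s : M, IsSucc n s ∧ s ε a
  separation : ∀ P : Set M, Set.Definable₁ Set.univ setLang P →
    ∀ a : M, ∃ b : M, ∀ z : M, z ε b ↔ z ε a ∧ z ∈ P
  replacement : ∀ F : M → M → Prop,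
    Set.Definable₂ Set.univ setLang {x : M × M | F x.1 x.2} →
    ∀ a : M, (∀ x : M, x ε a → ∃! y : M, F x y) →
      ∃ b : M, ∀ y : M, y ε b ↔ ∃ x : M, x ε a ∧ F x y

end Formulas

/-- `M` is a transitive class. -/
def IsTransClass (M : Set ZFSet.{u}) : Prop := ∀ x ∈ M, ∀ y ∈ x, y ∈ M

/-- `HOD^M`, for a class `M` of sets. -/
def HOD (M : Set ZFSet.{u}) : Set ZFSet.{u} :=
  {x | ∃ h : x ∈ M, IsHOD (⟨x, h⟩ : M)}

end SetModel

/-! An ordinal definable set `x` of `M₁` is the only set given by its data `(β, n, c, p)`: a stage,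
a number of variables, a formula and parameters. As `M₁` is well-founded, `n` is finite, `c` is a
genuine formula and `p` is a finite function, so the data are built from ordinals and the empty set
by finitely many pairings and adjunctions. Elementary embeddings preserve these operations and `j₁`,
`j₂` agree on ordinals, so `j₁` maps the data into the range of `j₂`. Elementarity of `j₂` then
yields a set of `M₂` with the corresponding data, and uniqueness in `N` forces its image to be `j₁
x` (`IsOD.map_mem_range`).

By symmetry, each embedding maps its hereditarily ordinal definable sets into the range of the
other. By ∈-induction, such sets with the same image in `N` are equal (`IsHOD.val_eq_of_map_eq`),
which gives both claims. -/

namespace SetModel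

/-! ### First-order formulas expressing the set-theoretic predicates. -/

section Formulas

variable {M : Type w} [setLang.Structure M] {n : ℕ}

/-- Formulas of the language `{∈}` in the variables `0, …, n - 1`. -/
abbrev Fml (n : ℕ) := setLang.BoundedFormula Empty n

local postfix:max "↟" => Fin.castSucc

/-- The argument of `f` stands for the newly bound variable `Fin.last n`; an outer variable takes
one `↟` for each quantifier it crosses. -/
def exF (f : Fin (n + 1) → Fml (n + 1)) : Fml n := (f (Fin.last n)).ex

def allF (f : Fin (n + 1) → Fml (n + 1)) : Fml n := (f (Fin.last n)).all

def fEq (a b : Fin n) : Fml n :=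
  (Language.Term.var (Sum.inr a)).bdEqual (Language.Term.var (Sum.inr b))

def fMem (a b : Fin n) : Fml n :=
  Language.Relations.boundedFormula₂ (L := setLang) MemRel.mem
    (Language.Term.var (Sum.inr a)) (Language.Term.var (Sum.inr b))

@[simp] theorem realize_exF (f : Fin (n + 1) → Fml (n + 1)) (e : Empty → M) (v : Fin n → M) :
    (exF f).Realize e v ↔ ∃ a : M, (f (Fin.last n)).Realize e (Fin.snoc v a) := by
  simp [exF]

@[simp] theorem realize_allF (f : Fin (n + 1) → Fml (n + 1)) (e : Empty → M) (v : Fin n → M) :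
    (allF f).Realize e v ↔ ∀ a : M, (f (Fin.last n)).Realize e (Fin.snoc v a) := by
  simp [allF]

@[simp] theorem realize_fEq (a b : Fin n) (e : Empty → M) (v : Fin n → M) :
    (fEq a b).Realize e v ↔ v a = v b := by
  simp [fEq]

@[simp] theorem realize_fMem (a b : Fin n) (e : Empty → M) (v : Fin n → M) :
    (fMem a b).Realize e v ↔ Mem (v a) (v b) := by
  exact Language.BoundedFormula.realize_rel₂

def fSub (a b : Fin n) : Fml n := allF fun z => fMem z a↟ ⟹ fMem z b↟

@[simp] theorem realize_fSub (a b : Fin n) (e : Empty → M) (v : Fin n → M) :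
    (fSub a b).Realize e v ↔ Sub (v a) (v b) := by
  simp [fSub, Sub]

def fZero (a : Fin n) : Fml n := allF fun z => ∼(fMem z a↟)

@[simp] theorem realize_fZero (a : Fin n) (e : Empty → M) (v : Fin n → M) :
    (fZero a).Realize e v ↔ IsZero (v a) := by
  simp [fZero, IsZero]

/-- `t = s ∪ {a}`. -/
def IsAdjoin (a s t : M) : Prop := ∀ z : M, Mem z t ↔ Mem z s ∨ z = a

def fAdjoin (a s t : Fin n) : Fml n :=
  allF fun z => fMem z t↟ ⇔ (fMem z s↟ ⊔ fEq z a↟)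

@[simp] theorem realize_fAdjoin (a s t : Fin n) (e : Empty → M) (v : Fin n → M) :
    (fAdjoin a s t).Realize e v ↔ IsAdjoin (v a) (v s) (v t) := by
  simp [fAdjoin, IsAdjoin]

def fSucc (a s : Fin n) : Fml n := fAdjoin a a s

@[simp] theorem realize_fSucc (a s : Fin n) (e : Empty → M) (v : Fin n → M) :
    (fSucc a s).Realize e v ↔ IsSucc (v a) (v s) := by
  simp [fSucc, IsAdjoin, IsSucc]

def fPair (a b c : Fin n) : Fml n :=
  allF fun z => fMem z c↟ ⇔ (fEq z a↟ ⊔ fEq z b↟)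

@[simp] theorem realize_fPair (a b c : Fin n) (e : Empty → M) (v : Fin n → M) :
    (fPair a b c).Realize e v ↔ IsPair (v a) (v b) (v c) := by
  simp [fPair, IsPair]

def fOPair (a b c : Fin n) : Fml n :=
  exF fun d => exF fun e => fPair a↟↟ a↟↟ d↟ ⊓ (fPair a↟↟ b↟↟ e ⊓ fPair d↟ e c↟↟)

@[simp] theorem realize_fOPair (a b c : Fin n) (e : Empty → M) (v : Fin n → M) :
    (fOPair a b c).Realize e v ↔ IsOPair (v a) (v b) (v c) := by
  simp [fOPair, IsOPair]

def fTrans (a : Fin n) : Fml n := allF fun y => fMem y a↟ ⟹ fSub y a↟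

@[simp] theorem realize_fTrans (a : Fin n) (e : Empty → M) (v : Fin n → M) :
    (fTrans a).Realize e v ↔ IsTrans (v a) := by
  simp [fTrans, IsTrans]

def fOrd (a : Fin n) : Fml n := fTrans a ⊓ allF fun y => fMem y a↟ ⟹ fTrans y

@[simp] theorem realize_fOrd (a : Fin n) (e : Empty → M) (v : Fin n → M) :
    (fOrd a).Realize e v ↔ IsOrd (v a) := by
  simp [fOrd, IsOrd]

def fNat (a : Fin n) : Fml n :=
  fOrd a ⊓ allF fun k => (fMem k a↟ ⊔ fEq k a↟) ⟹ (fZero k ⊔ exF fun m => fSucc m k↟)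

@[simp] theorem realize_fNat (a : Fin n) (e : Empty → M) (v : Fin n → M) :
    (fNat a).Realize e v ↔ IsNat (v a) := by
  simp [fNat, IsNat]

def fApp (f x y : Fin n) : Fml n := exF fun p => fOPair x↟ y↟ p ⊓ fMem p f↟

@[simp] theorem realize_fApp (f x y : Fin n) (e : Empty → M) (v : Fin n → M) :
    (fApp f x y).Realize e v ↔ App (v f) (v x) (v y) := by
  simp [fApp, App]

def fFunOn (f d : Fin n) : Fml n :=
  (allF fun p => fMem p f↟ ⟹ exF fun x => exF fun y => fMem x↟ d↟↟↟ ⊓ fOPair x↟ y p↟↟) ⊓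
    allF fun x => fMem x d↟ ⟹ exF fun y => fApp f↟↟ x↟ y ⊓
      allF fun y' => fApp f↟↟↟ x↟↟ y' ⟹ fEq y' y↟

@[simp] theorem realize_fFunOn (f d : Fin n) (e : Empty → M) (v : Fin n → M) :
    (fFunOn f d).Realize e v ↔ IsFunOn (v f) (v d) := by
  simp [fFunOn, IsFunOn, ExistsUnique]

def fFunTo (f d a : Fin n) : Fml n :=
  fFunOn f d ⊓ allF fun x => allF fun y => fApp f↟↟ x↟ y ⟹ fMem y a↟↟

@[simp] theorem realize_fFunTo (f d a : Fin n) (e : Empty → M) (v : Fin n → M) :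
    (fFunTo f d a).Realize e v ↔ IsFunTo (v f) (v d) (v a) := by
  simp [fFunTo, IsFunTo]

def fVStage (β A : Fin n) : Fml n :=
  exF fun s => exF fun h => fSucc β↟↟ s↟ ⊓ (fFunOn h s↟ ⊓
    ((allF fun α => allF fun y => fMem α↟ s↟↟↟ ⟹ (fApp h↟↟ α↟ y ⟹
      allF fun z => fMem z y↟ ⇔ exF fun γ => exF fun u =>
        fMem γ↟ α↟↟↟↟ ⊓ (fApp h↟↟↟↟↟ γ↟ u ⊓ fSub z↟↟ u))) ⊓
    fApp h β↟↟ A↟↟))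

@[simp] theorem realize_fVStage (β A : Fin n) (e : Empty → M) (v : Fin n → M) :
    (fVStage β A).Realize e v ↔ IsVStage (v β) (v A) := by
  simp [fVStage, IsVStage]

def fNumeral : {n : ℕ} → ℕ → Fin n → Fml n
  | _, 0, a => fZero a
  | _, k + 1, a => exF fun b => fNumeral k b ⊓ fSucc b a↟

@[simp] theorem realize_fNumeral (k : ℕ) (a : Fin n) (e : Empty → M) (v : Fin n → M) :
    (fNumeral k a).Realize e v ↔ IsNumeral k (v a) := by
  induction k generalizing n with
  | zero => simp [fNumeral, IsNumeral]
  | succ k ih => simp [fNumeral, IsNumeral, ih]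

def fCode (k : ℕ) (a b c : Fin n) : Fml n :=
  exF fun t => exF fun p => fNumeral k t↟ ⊓ (fOPair a↟↟ b↟↟ p ⊓ fOPair t↟ p c↟↟)

@[simp] theorem realize_fCode (k : ℕ) (a b c : Fin n) (e : Empty → M) (v : Fin n → M) :
    (fCode k a b c).Realize e v ↔ IsCode k (v a) (v b) (v c) := by
  simp [fCode, IsCode]

def fUpdate (d p i y q : Fin n) : Fml n :=
  fFunOn q d ⊓ (fApp q i y ⊓ allF fun k => allF fun z =>
    fMem k↟ d↟↟ ⟹ (∼(fEq k↟ i↟↟) ⟹ (fApp q↟↟ k↟ z ⇔ fApp p↟↟ k↟ z)))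

@[simp] theorem realize_fUpdate (d p i y q : Fin n) (e : Empty → M) (v : Fin n → M) :
    (fUpdate d p i y q).Realize e v ↔ IsUpdate (v d) (v p) (v i) (v y) (v q) := by
  simp [fUpdate, IsUpdate]

def fSat (A d D S : Fin n) : Fml n :=
  fFunOn S D ⊓ allF fun c => allF fun T => fMem c↟ D↟↟ ⟹ (fApp S↟↟ c↟ T ⟹
    ((exF fun i => exF fun j => fMem i↟ d↟↟↟↟ ⊓ (fMem j d↟↟↟↟ ⊓ (fCode 0 i↟ j c↟↟↟ ⊓
        allF fun q => fMem q T↟↟↟ ⇔ (fFunTo q d↟↟↟↟↟ A↟↟↟↟↟ ⊓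
          exF fun a => fApp q↟ i↟↟↟ a ⊓ fApp q↟ j↟↟ a)))) ⊔
    ((exF fun i => exF fun j => fMem i↟ d↟↟↟↟ ⊓ (fMem j d↟↟↟↟ ⊓ (fCode 1 i↟ j c↟↟↟ ⊓
        allF fun q => fMem q T↟↟↟ ⇔ (fFunTo q d↟↟↟↟↟ A↟↟↟↟↟ ⊓
          exF fun a => exF fun b => fApp q↟↟ i↟↟↟↟ a↟ ⊓ (fApp q↟↟ j↟↟↟ b ⊓ fMem a↟ b))))) ⊔
    ((exF fun φ => exF fun U => fMem φ↟ D↟↟↟↟ ⊓ (fApp S↟↟↟↟ φ↟ U ⊓ (fCode 2 φ↟ φ↟ c↟↟↟ ⊓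
        allF fun q => fMem q T↟↟↟ ⇔ (fFunTo q d↟↟↟↟↟ A↟↟↟↟↟ ⊓ ∼(fMem q U↟))))) ⊔
    ((exF fun φ => exF fun ψ => exF fun U => exF fun W =>
        fMem φ↟↟↟ D↟↟↟↟↟↟ ⊓ (fMem ψ↟↟ D↟↟↟↟↟↟ ⊓ (fApp S↟↟↟↟↟↟ φ↟↟↟ U↟ ⊓
        (fApp S↟↟↟↟↟↟ ψ↟↟ W ⊓ (fCode 3 φ↟↟↟ ψ↟↟ c↟↟↟↟↟ ⊓
        allF fun q => fMem q T↟↟↟↟↟ ⇔ (fFunTo q d↟↟↟↟↟↟↟ A↟↟↟↟↟↟↟ ⊓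
          (fMem q U↟↟ ⊓ fMem q W↟))))))) ⊔
    (exF fun i => exF fun φ => exF fun U =>
        fMem i↟↟ d↟↟↟↟↟ ⊓ (fMem φ↟ D↟↟↟↟↟ ⊓ (fApp S↟↟↟↟↟ φ↟ U ⊓ (fCode 4 i↟↟ φ↟ c↟↟↟↟ ⊓
        allF fun q => fMem q T↟↟↟↟ ⇔ (fFunTo q d↟↟↟↟↟↟ A↟↟↟↟↟↟ ⊓
          exF fun a => exF fun r => fMem a↟ A↟↟↟↟↟↟↟↟ ⊓
            (fUpdate d↟↟↟↟↟↟↟↟ q↟↟ i↟↟↟↟↟ a↟ r ⊓ fMem r U↟↟↟)))))))))))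

@[simp] theorem realize_fSat (A d D S : Fin n) (e : Empty → M) (v : Fin n → M) :
    (fSat A d D S).Realize e v ↔ IsSat (v A) (v d) (v D) (v S) := by
  simp [fSat, IsSat]

/-- `x` is the ordinal definable set given by the formula `c` in `n` variables, evaluated in
`V_β` with the ordinal parameters `p`. -/
def IsDefinedBy (β n c p x : M) : Prop :=
  ∃ A o D S T : M,
    IsOrd β ∧ IsVStage β A ∧ IsNat n ∧ IsZero o ∧ Mem o n ∧
    IsSat A n D S ∧ Mem c D ∧ App S c T ∧ IsFunTo p n β ∧ Mem x A ∧
    ∀ y : M, Mem y A → ((∃ q : M, IsUpdate n p o y q ∧ Mem q T) ↔ y = x)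

/-- This isolates the four data that have to be moved between models from the auxiliary witnesses.
-/
theorem isOD_iff (x : M) : IsOD x ↔ ∃ β n c p : M, IsDefinedBy β n c p x := by
  constructor
  · rintro ⟨β, A, n, o, D, S, c, T, p, h⟩
    exact ⟨β, n, c, p, A, o, D, S, T, h⟩
  · rintro ⟨β, n, c, p, A, o, D, S, T, h⟩
    exact ⟨β, A, n, o, D, S, c, T, p, h⟩

def fDefinedBy (β d c p x : Fin n) : Fml n :=
  exF fun A => exF fun o => exF fun D => exF fun S => exF fun T =>
    fOrd β↟↟↟↟↟ ⊓ (fVStage β↟↟↟↟↟ A↟↟↟↟ ⊓ (fNat d↟↟↟↟↟ ⊓ (fZero o↟↟↟ ⊓ (fMem o↟↟↟ d↟↟↟↟↟ ⊓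
    (fSat A↟↟↟↟ d↟↟↟↟↟ D↟↟ S↟ ⊓ (fMem c↟↟↟↟↟ D↟↟ ⊓ (fApp S↟ c↟↟↟↟↟ T ⊓
    (fFunTo p↟↟↟↟↟ d↟↟↟↟↟ β↟↟↟↟↟ ⊓ (fMem x↟↟↟↟↟ A↟↟↟↟ ⊓
    allF fun y => fMem y A↟↟↟↟↟ ⟹
      ((exF fun q => fUpdate d↟↟↟↟↟↟↟ p↟↟↟↟↟↟↟ o↟↟↟↟↟ y↟ q ⊓ fMem q T↟↟) ⇔
        fEq y x↟↟↟↟↟↟))))))))))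

@[simp] theorem realize_fDefinedBy (β d c p x : Fin n) (e : Empty → M) (v : Fin n → M) :
    (fDefinedBy β d c p x).Realize e v ↔ IsDefinedBy (v β) (v d) (v c) (v p) (v x) := by
  simp [fDefinedBy, IsDefinedBy]

def fOD (x : Fin n) : Fml n :=
  exF fun β => exF fun d => exF fun c => exF fun p => fDefinedBy β↟↟↟ d↟↟ c↟ p x↟↟↟↟

@[simp] theorem realize_fOD (x : Fin n) (e : Empty → M) (v : Fin n → M) :
    (fOD x).Realize e v ↔ IsOD (v x) := by
  simp [fOD, isOD_iff]

def fHOD (x : Fin n) : Fml n :=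
  exF fun t => fTrans t ⊓ (fMem x↟ t ⊓ allF fun y => fMem y t↟ ⟹ fOD y)

@[simp] theorem realize_fHOD (x : Fin n) (e : Empty → M) (v : Fin n → M) :
    (fHOD x).Realize e v ↔ IsHOD (v x) := by
  simp [fHOD, IsHOD]

end Formulas

/-! ### Transfer along elementary embeddings. -/

section Elementary

local postfix:max "↟" => Fin.castSucc

variable {M : Type*} {N : Type*} [setLang.Structure M] [setLang.Structure N] (j : M ↪ₑ[setLang] N)

theorem realize_elementary {n : ℕ} (φ : Fml n) (v : Fin n → M) :
    φ.Realize (default : Empty → N) (j ∘ v) ↔ φ.Realize (default : Empty → M) v := by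
  rw [← j.map_boundedFormula φ default v, Subsingleton.elim (j ∘ default) (default : Empty → N)]

theorem mem_elementary (a b : M) : Mem (j a) (j b) ↔ Mem a b := by
  simpa using realize_elementary j (fMem 0 1) ![a, b]

theorem isHOD_elementary (a : M) : IsHOD (j a) ↔ IsHOD a := by
  simpa using realize_elementary j (fHOD 0) ![a]

theorem isZero_elementary (a : M) : IsZero (j a) ↔ IsZero a := by
  simpa using realize_elementary j (fZero 0) ![a]

theorem isAdjoin_elementary (a s t : M) : IsAdjoin (j a) (j s) (j t) ↔ IsAdjoin a s t := by
  simpa using realize_elementary j (fAdjoin 0 1 2) ![a, s, t]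

theorem isOPair_elementary (a b c : M) : IsOPair (j a) (j b) (j c) ↔ IsOPair a b c := by
  simpa using realize_elementary j (fOPair 0 1 2) ![a, b, c]

theorem isDefinedBy_elementary (β n c p x : M) :
    IsDefinedBy (j β) (j n) (j c) (j p) (j x) ↔ IsDefinedBy β n c p x := by
  simpa using realize_elementary j (fDefinedBy 0 1 2 3 4) ![β, n, c, p, x]

theorem exists_isZero_elementary (j : M ↪ₑ[setLang] N) : (∃ a : N, IsZero a) ↔ ∃ a : M, IsZero a := by
  have h := realize_elementary j (exF fun a => fZero a) ![]
  simp only [realize_exF, realize_fZero, Fin.snoc_last] at h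
  exact h

theorem exists_isAdjoin_elementary (a s : M) :
    (∃ t : N, IsAdjoin (j a) (j s) t) ↔ ∃ t : M, IsAdjoin a s t := by
  have h := realize_elementary j (exF fun t => fAdjoin (0 : Fin 2)↟ (1 : Fin 2)↟ t) ![a, s]
  simp only [realize_exF, realize_fAdjoin, Fin.snoc_castSucc, Fin.snoc_last] at h
  exact h

theorem exists_isOPair_elementary (a b : M) :
    (∃ c : N, IsOPair (j a) (j b) c) ↔ ∃ c : M, IsOPair a b c := by
  have h := realize_elementary j (exF fun c => fOPair (0 : Fin 2)↟ (1 : Fin 2)↟ c) ![a, b]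
  simp only [realize_exF, realize_fOPair, Fin.snoc_castSucc, Fin.snoc_last] at h
  exact h

theorem exists_isDefinedBy_elementary (β n c p : M) :
    (∃ x : N, IsDefinedBy (j β) (j n) (j c) (j p) x) ↔ ∃ x : M, IsDefinedBy β n c p x := by
  have h := realize_elementary j
    (exF fun x => fDefinedBy (0 : Fin 4)↟ (1 : Fin 4)↟ (2 : Fin 4)↟ (3 : Fin 4)↟ x) ![β, n, c, p]
  simp only [realize_exF, realize_fDefinedBy, Fin.snoc_castSucc, Fin.snoc_last] at h
  exact h

theorem forall_isDefinedBy_elementary (β n c p x : M) :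
    (∀ y : N, IsDefinedBy (j β) (j n) (j c) (j p) y → y = j x) ↔
      ∀ y : M, IsDefinedBy β n c p y → y = x := by
  have h := realize_elementary j
    (allF fun y => fDefinedBy (0 : Fin 5)↟ (1 : Fin 5)↟ (2 : Fin 5)↟ (3 : Fin 5)↟ y ⟹
      fEq y (4 : Fin 5)↟) ![β, n, c, p, x]
  simp only [realize_allF, Language.BoundedFormula.realize_imp, realize_fEq, realize_fDefinedBy,
    Fin.snoc_castSucc, Fin.snoc_last] at h
  exact h

end Elementary

/-! ### Uniqueness and finiteness in well-founded models. -/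

section WellFounded

variable {M : Type*} [setLang.Structure M]

theorem isOPair_inj {a b a' b' c : M} (h : IsOPair a b c) (h' : IsOPair a' b' c) :
    a = a' ∧ b = b' := by
  obtain ⟨d, e, hd, he, hc⟩ := h
  obtain ⟨d', e', hd', he', hc'⟩ := h'
  have ha : a = a' := by
    have had' : Mem a' d := by
      rcases (hc' d).1 ((hc d).2 (Or.inl rfl)) with rfl | rfl
      · exact (hd' a').2 (Or.inl rfl)
      · exact (he' a').2 (Or.inl rfl)
    rcases (hd a').1 had' with h | h <;> exact h.symm
  subst ha
  refine ⟨rfl, ?_⟩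
  have h₁ : b = a ∨ b = b' := by
    have hb := (he b).2 (Or.inr rfl)
    rcases (hc' e).1 ((hc e).2 (Or.inr rfl)) with rfl | rfl
    · exact Or.inl (by rcases (hd' b).1 hb with h | h <;> exact h)
    · exact (he' b).1 hb
  have h₂ : b' = a ∨ b' = b := by
    have hb := (he' b').2 (Or.inr rfl)
    rcases (hc e').1 ((hc' e').2 (Or.inr rfl)) with rfl | rfl
    · exact Or.inl (by rcases (hd b').1 hb with h | h <;> exact h)
    · exact (he b').1 hb
  rcases h₁ with h₁ | h₁
  · rcases h₂ with h₂ | h₂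
    · exact h₁.trans h₂.symm
    · exact h₂.symm
  · exact h₁

/-- Extensionality for the structure `M`. -/
def Extensional (M : Type*) [setLang.Structure M] : Prop :=
  ∀ a b : M, (∀ z : M, Mem z a ↔ Mem z b) → a = b

theorem Extensional.eq_of_iff (ext : Extensional M) {P : M → Prop} {a b : M}
    (ha : ∀ z, Mem z a ↔ P z) (hb : ∀ z, Mem z b ↔ P z) : a = b :=
  ext a b fun z => (ha z).trans (hb z).symm

theorem Extensional.isZero_unique (ext : Extensional M) {a b : M} (ha : IsZero a)
    (hb : IsZero b) : a = b :=
  ext a b fun z => iff_of_false (ha z) (hb z)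

theorem Extensional.isOPair_unique (ext : Extensional M) {a b c c' : M} (h : IsOPair a b c)
    (h' : IsOPair a b c') : c = c' := by
  obtain ⟨d, e, hd, he, hc⟩ := h
  obtain ⟨d', e', hd', he', hc'⟩ := h'
  obtain rfl := ext.eq_of_iff hd hd'
  obtain rfl := ext.eq_of_iff he he'
  exact ext.eq_of_iff hc hc'

theorem IsOrd.mem {a b : M} (ha : IsOrd a) (hb : Mem b a) : IsOrd b :=
  ⟨ha.2 b hb, fun y hy => ha.2 y (ha.1 b hb y hy)⟩

theorem IsSucc.self_mem {a s : M} (h : IsSucc a s) : Mem a s := (h a).2 (Or.inr rfl)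

theorem IsNat.mem_or_eq_of_isSucc {n k m : M} (hn : IsNat n) (hk : Mem k n ∨ k = n)
    (hm : IsSucc m k) : Mem m n := by
  rcases hk with hk | rfl
  · exact hn.1.1 k hk m hm.self_mem
  · exact hm.self_mem

variable (wf : WellFounded (Mem : M → M → Prop)) (ext : Extensional M)
include wf

theorem IsSucc.inj {a b s : M} (ha : IsSucc a s) (hb : IsSucc b s) : a = b := by
  rcases (hb a).1 ha.self_mem with h | h
  · rcases (ha b).1 hb.self_mem with h' | h'
    · exact absurd h' (wf.asymmetric _ _ h)
    · exact h'.symm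
  · exact h

theorem IsNumeral.inj {k l : ℕ} {a : M} (h : IsNumeral k a) (h' : IsNumeral l a) : k = l := by
  induction k generalizing l a with
  | zero =>
    cases l with
    | zero => rfl
    | succ l =>
      obtain ⟨b, -, hb⟩ := h'
      exact absurd hb.self_mem (h b)
  | succ k ih =>
    obtain ⟨b, hk, hb⟩ := h
    cases l with
    | zero => exact absurd hb.self_mem (h' b)
    | succ l =>
      obtain ⟨b', hl, hb'⟩ := h'
      obtain rfl := hb.inj wf hb'
      rw [ih hk hl]

theorem IsCode.inj {k l : ℕ} {a b a' b' c : M} (h : IsCode k a b c) (h' : IsCode l a' b' c) :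
    k = l ∧ a = a' ∧ b = b' := by
  obtain ⟨t, p, ht, hp, hc⟩ := h
  obtain ⟨t', p', ht', hp', hc'⟩ := h'
  obtain ⟨rfl, rfl⟩ := isOPair_inj hc hc'
  exact ⟨ht.inj wf ht', isOPair_inj hp hp'⟩

/-- Well-foundedness excludes nonstandard numbers: every nonzero `k ≤ n` is `m ∪ {m}` for some
smaller `m`. -/
theorem IsNat.finite {n : M} (hn : IsNat n) : {z | Mem z n}.Finite := by
  suffices ∀ k, Mem k n ∨ k = n → {z | Mem z k}.Finite from this n (Or.inr rfl)
  intro k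
  induction k using wf.induction with
  | _ k ih =>
    intro hk
    rcases hn.2 k hk with h | ⟨m, hm⟩
    · exact Set.finite_empty.subset fun z hz => h z hz
    · refine ((ih m hm.self_mem (Or.inl (hn.mem_or_eq_of_isSucc hk hm))).insert m).subset ?_
      intro z hz
      exact ((hm z).1 hz).symm

omit wf

theorem IsOPair.left_transGen {a b c : M} (h : IsOPair a b c) :
    Relation.TransGen Mem a c := by
  obtain ⟨d, e, hd, -, hc⟩ := h
  exact (Relation.TransGen.single ((hd a).2 (Or.inl rfl))).tail ((hc d).2 (Or.inl rfl))

theorem IsOPair.right_transGen {a b c : M} (h : IsOPair a b c) :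
    Relation.TransGen Mem b c := by
  obtain ⟨d, e, -, he, hc⟩ := h
  exact (Relation.TransGen.single ((he b).2 (Or.inr rfl))).tail ((hc e).2 (Or.inr rfl))

/-- Subformulas lie below a code in the transitive closure of membership, which permits induction on
formulas. -/
theorem IsCode.left_transGen {k : ℕ} {a b c : M} (h : IsCode k a b c) :
    Relation.TransGen Mem a c := by
  obtain ⟨t, p, -, hp, hc⟩ := h
  exact hp.left_transGen.trans hc.right_transGen

theorem IsCode.right_transGen {k : ℕ} {a b c : M} (h : IsCode k a b c) :
    Relation.TransGen Mem b c := by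
  obtain ⟨t, p, -, hp, hc⟩ := h
  exact hp.right_transGen.trans hc.right_transGen

theorem IsFunOn.finite {f d : M} (ext : Extensional M) (hf : IsFunOn f d)
    (hd : {z | Mem z d}.Finite) : {z | Mem z f}.Finite := by
  -- The injection sends a pair to its first coordinate; the default `p` is never taken, since
  -- members of `f` are pairs.
  refine Set.Finite.of_injOn (f := fun p => open Classical in
    if h : ∃ x y : M, Mem x d ∧ IsOPair x y p then h.choose else p) (t := {z | Mem z d}) ?_ ?_ hd
  · intro p hp
    have h := hf.1 p hp
    obtain ⟨y, hy, -⟩ := h.choose_spec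
    simp only [h, dif_pos]
    exact hy
  · intro p hp q hq hpq
    have h := hf.1 p hp
    have h' := hf.1 q hq
    simp only [h, h', dif_pos] at hpq
    obtain ⟨y, hx, hy⟩ := h.choose_spec
    obtain ⟨y', -, hy'⟩ := h'.choose_spec
    rw [← hpq] at hy'
    obtain rfl := (hf.2 _ hx).unique ⟨p, hy, hp⟩ ⟨q, hy', hq⟩
    exact ext.isOPair_unique hy hy'

include wf ext

theorem IsVStage.unique {β A A' : M} (hβ : IsOrd β) (h : IsVStage β A) (h' : IsVStage β A') :
    A = A' := by
  obtain ⟨s, f, hs, hf, hrec, hA⟩ := h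
  obtain ⟨s', f', hs', hf', hrec', hA'⟩ := h'
  obtain rfl := ext.eq_of_iff hs hs'
  have trans : ∀ α γ, Mem α s → Mem γ α → Mem γ s := by
    intro α γ hα hγ
    rcases (hs α).1 hα with h | rfl
    · exact (hs γ).2 (Or.inl (hβ.1 α h γ hγ))
    · exact (hs γ).2 (Or.inl hγ)
  have key : ∀ α, Mem α s → ∀ y y', App f α y → App f' α y' → y = y' := by
    intro α
    induction α using wf.induction with
    | _ α ih =>
      intro hα y y' hy hy'
      refine ext y y' fun z => ?_
      rw [hrec α y hα hy, hrec' α y' hα hy']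
      constructor
      · rintro ⟨γ, v, hγ, hv, hz⟩
        obtain ⟨v', hv', -⟩ := hf'.2 γ (trans α γ hα hγ)
        obtain rfl := ih γ hγ (trans α γ hα hγ) v v' hv hv'
        exact ⟨γ, v, hγ, hv', hz⟩
      · rintro ⟨γ, v, hγ, hv, hz⟩
        obtain ⟨v', hv', -⟩ := hf.2 γ (trans α γ hα hγ)
        obtain rfl := ih γ hγ (trans α γ hα hγ) v' v hv' hv
        exact ⟨γ, v', hγ, hv', hz⟩
  exact key β hs.self_mem A A' hA hA'

/-- By induction on formulas, Tarski's clauses determine the value at `c` independently of `D` and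
`S`. -/
theorem IsSat.unique {A n D S D' S' c T T' : M} (h : IsSat A n D S) (h' : IsSat A n D' S')
    (hc : Mem c D) (hc' : Mem c D') (hT : App S c T) (hT' : App S' c T') : T = T' := by
  induction c using wf.transGen.induction generalizing T T' with
  | _ c ih =>
    rcases h.2 c T hc hT with ⟨i, j, hi, hj, hk, hq⟩ | ⟨i, j, hi, hj, hk, hq⟩ |
        ⟨φ, U, hφ, hU, hk, hq⟩ | ⟨φ, ψ, U, W, hφ, hψ, hU, hW, hk, hq⟩ |
        ⟨i, φ, U, hi, hφ, hU, hk, hq⟩ <;>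
      rcases h'.2 c T' hc' hT' with ⟨i', j', hi', hj', hk', hq'⟩ | ⟨i', j', hi', hj', hk', hq'⟩ |
        ⟨φ', U', hφ', hU', hk', hq'⟩ | ⟨φ', ψ', U', W', hφ', hψ', hU', hW', hk', hq'⟩ |
        ⟨i', φ', U', hi', hφ', hU', hk', hq'⟩ <;>
      -- Of the 25 pairs of clauses, the 20 with different numeral tags are contradictory.
      obtain ⟨hkl, rfl, h₂⟩ := hk.inj wf hk' <;>
      first
        | exact absurd hkl (by decide)
        | skip
    · subst h₂
      exact ext.eq_of_iff hq hq'
    · subst h₂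
      exact ext.eq_of_iff hq hq'
    · obtain rfl := ih φ hk.left_transGen hφ hφ' hU hU'
      exact ext.eq_of_iff hq hq'
    · subst h₂
      obtain rfl := ih φ hk.left_transGen hφ hφ' hU hU'
      obtain rfl := ih ψ hk.right_transGen hψ hψ' hW hW'
      exact ext.eq_of_iff hq hq'
    · subst h₂
      obtain rfl := ih φ hk.right_transGen hφ hφ' hU hU'
      exact ext.eq_of_iff hq hq'

theorem IsDefinedBy.unique {β n c p x y : M} (hx : IsDefinedBy β n c p x)
    (hy : IsDefinedBy β n c p y) : y = x := by
  obtain ⟨A, o, D, S, T, hβ, hA, -, ho, -, hS, hc, hT, -, -, huniq⟩ := hx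
  obtain ⟨A', o', D', S', T', -, hA', -, ho', -, hS', hc', hT', -, hyA, huniq'⟩ := hy
  obtain rfl := hA.unique wf ext hβ hA'
  obtain rfl := ext.isZero_unique ho ho'
  obtain rfl := hS.unique wf ext hS' hc hc' hT hT'
  exact (huniq y hyA).1 ((huniq' y hyA).2 rfl)

end WellFounded

/-! ### Ordinal definable sets are mapped into the range of the other embedding. -/

section Lift

variable {M₁ M₂ N : Type*} [setLang.Structure M₁] [setLang.Structure M₂] [setLang.Structure N]
  {j₁ : M₁ ↪ₑ[setLang] N} {j₂ : M₂ ↪ₑ[setLang] N} (extN : Extensional N)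

theorem IsModelZF.exists_isAdjoin {M : Type*} [setLang.Structure M] (zf : IsModelZF M) (a s : M) :
    ∃ t, IsAdjoin a s t := by
  obtain ⟨c, hc⟩ := zf.pairing a a
  obtain ⟨d, hd⟩ := zf.pairing s c
  obtain ⟨t, ht⟩ := zf.union d
  refine ⟨t, fun z => (ht z).trans ⟨?_, ?_⟩⟩
  · rintro ⟨y, hy, hz⟩
    rcases (hd y).1 hy with rfl | rfl
    · exact Or.inl hz
    · exact Or.inr (by rcases (hc z).1 hz with h | h <;> exact h)
  · rintro (hz | rfl)
    · exact ⟨s, (hd s).2 (Or.inl rfl), hz⟩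
    · exact ⟨c, (hd c).2 (Or.inr rfl), (hc z).2 (Or.inl rfl)⟩

include extN

/-- Pattern for the next lemmas: existence in `N` is pulled back along `j₂`, and extensionality of
`N` identifies the image of the witness. -/
theorem IsZero.map_mem_range {a : M₁} (h : IsZero a) : j₁ a ∈ Set.range j₂ := by
  have h' := (isZero_elementary j₁ a).2 h
  obtain ⟨b, hb⟩ := (exists_isZero_elementary j₂).1 ⟨_, h'⟩
  exact ⟨b, extN.isZero_unique ((isZero_elementary j₂ b).2 hb) h'⟩

theorem IsAdjoin.map_mem_range {a s t : M₁} (h : IsAdjoin a s t) (ha : j₁ a ∈ Set.range j₂)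
    (hs : j₁ s ∈ Set.range j₂) : j₁ t ∈ Set.range j₂ := by
  obtain ⟨a', ha⟩ := ha
  obtain ⟨s', hs⟩ := hs
  have h' := (isAdjoin_elementary j₁ a s t).2 h
  rw [← ha, ← hs] at h'
  obtain ⟨t', ht⟩ := (exists_isAdjoin_elementary j₂ a' s').1 ⟨_, h'⟩
  exact ⟨t', extN.eq_of_iff ((isAdjoin_elementary j₂ a' s' t').2 ht) h'⟩

theorem IsOPair.map_mem_range {a b c : M₁} (h : IsOPair a b c) (ha : j₁ a ∈ Set.range j₂)
    (hb : j₁ b ∈ Set.range j₂) : j₁ c ∈ Set.range j₂ := by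
  obtain ⟨a', ha⟩ := ha
  obtain ⟨b', hb⟩ := hb
  have h' := (isOPair_elementary j₁ a b c).2 h
  rw [← ha, ← hb] at h'
  obtain ⟨c', hc⟩ := (exists_isOPair_elementary j₂ a' b').1 ⟨_, h'⟩
  exact ⟨c', extN.isOPair_unique ((isOPair_elementary j₂ a' b' c').2 hc) h'⟩

theorem IsNumeral.map_mem_range {k : ℕ} {a : M₁} (h : IsNumeral k a) :
    j₁ a ∈ Set.range j₂ := by
  induction k generalizing a with
  | zero => exact IsZero.map_mem_range extN h
  | succ k ih =>
    obtain ⟨b, hb, hs⟩ := h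
    exact IsAdjoin.map_mem_range (a := b) (s := b) extN hs (ih hb) (ih hb)

theorem IsCode.map_mem_range {k : ℕ} {a b c : M₁} (h : IsCode k a b c)
    (ha : j₁ a ∈ Set.range j₂) (hb : j₁ b ∈ Set.range j₂) : j₁ c ∈ Set.range j₂ := by
  obtain ⟨t, p, ht, hp, hc⟩ := h
  exact hc.map_mem_range extN (ht.map_mem_range extN) (hp.map_mem_range extN ha hb)

theorem map_mem_range_of_finite (zf : IsModelZF M₁) {s : M₁} (hfin : {z | Mem z s}.Finite)
    (hs : ∀ z, Mem z s → j₁ z ∈ Set.range j₂) : j₁ s ∈ Set.range j₂ := by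
  -- The induction is on external finite sets, so it must also show that each is realized by an
  -- element of `M₁`.
  suffices ∀ S : Set M₁, S.Finite → (∀ z ∈ S, j₁ z ∈ Set.range j₂) →
      ∃ t, (∀ z, Mem z t ↔ z ∈ S) ∧ j₁ t ∈ Set.range j₂ by
    obtain ⟨t, ht, hj⟩ := this _ hfin hs
    rwa [zf.extensionality t s ht] at hj
  intro S hS
  induction S, hS using Set.Finite.induction_on with
  | empty =>
    intro _
    obtain ⟨-, ⟨z, hz, -⟩, -⟩ := zf.infinity
    exact ⟨z, fun y => iff_of_false (hz y) (Set.notMem_empty y), hz.map_mem_range extN⟩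
  | @insert a S _ _ ih =>
    intro h
    obtain ⟨t, ht, hj⟩ := ih fun z hz => h z (Set.mem_insert_of_mem a hz)
    obtain ⟨t', ht'⟩ := zf.exists_isAdjoin a t
    refine ⟨t', fun z => ?_, ht'.map_mem_range extN (h a (Set.mem_insert a S)) hj⟩
    rw [ht', ht, Set.mem_insert_iff, or_comm]

variable (hord : ∀ a : M₁, IsOrd a → j₁ a ∈ Set.range j₂)
  (wf : WellFounded (Mem : M₁ → M₁ → Prop))
include hord wf

/-- Induction on formulas: variable indices are members of `n`, hence ordinals, and numeral tags
come from the empty set by successors. -/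
theorem IsSat.map_mem_range {A n D S c T : M₁} (h : IsSat A n D S) (hn : IsNat n)
    (hc : Mem c D) (hT : App S c T) : j₁ c ∈ Set.range j₂ := by
  have hvar : ∀ i, Mem i n → j₁ i ∈ Set.range j₂ := fun i hi => hord i (hn.1.mem hi)
  induction c using wf.transGen.induction generalizing T with
  | _ c ih =>
    rcases h.2 c T hc hT with ⟨i, j, hi, hj, hk, -⟩ | ⟨i, j, hi, hj, hk, -⟩ |
        ⟨φ, U, hφ, hU, hk, -⟩ | ⟨φ, ψ, U, W, hφ, hψ, hU, hW, hk, -⟩ |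
        ⟨i, φ, U, hi, hφ, hU, hk, -⟩
    · exact hk.map_mem_range extN (hvar i hi) (hvar j hj)
    · exact hk.map_mem_range extN (hvar i hi) (hvar j hj)
    · have := ih φ hk.left_transGen hφ hU
      exact hk.map_mem_range extN this this
    · exact hk.map_mem_range extN (ih φ hk.left_transGen hφ hU) (ih ψ hk.right_transGen hψ hW)
    · exact hk.map_mem_range extN (hvar i hi) (ih φ hk.right_transGen hφ hU)

theorem IsFunTo.map_mem_range (zf : IsModelZF M₁) {p n β : M₁} (h : IsFunTo p n β)
    (hn : IsNat n) (hβ : IsOrd β) : j₁ p ∈ Set.range j₂ := by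
  refine map_mem_range_of_finite extN zf (h.1.finite zf.extensionality (hn.finite wf)) ?_
  intro z hz
  obtain ⟨x, y, hx, hxy⟩ := h.1.1 z hz
  exact hxy.map_mem_range extN (hord x (hn.1.mem hx)) (hord y (hβ.mem (h.2 x y ⟨z, hxy, hz⟩)))

theorem IsOD.map_mem_range (zf : IsModelZF M₁) {x : M₁} (h : IsOD x) :
    j₁ x ∈ Set.range j₂ := by
  obtain ⟨β, n, c, p, hx⟩ := (isOD_iff x).1 h
  -- Uniqueness is proved in the well-founded `M₁` and transferred, because `N` may be ill-founded.
  have huniq := (forall_isDefinedBy_elementary j₁ β n c p x).2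
    fun y => hx.unique wf zf.extensionality
  have hx' := (isDefinedBy_elementary j₁ β n c p x).2 hx
  obtain ⟨A, o, D, S, T, hβ, -, hn, -, -, hS, hc, hT, hp, -⟩ := hx
  obtain ⟨β', hβ'⟩ := hord β hβ
  obtain ⟨n', hn'⟩ := hord n hn.1
  obtain ⟨c', hc'⟩ := hS.map_mem_range extN hord wf hn hc hT
  obtain ⟨p', hp'⟩ := hp.map_mem_range extN hord wf zf hn hβ
  rw [← hβ', ← hn', ← hc', ← hp'] at hx' huniq
  obtain ⟨x', h'⟩ := (exists_isDefinedBy_elementary j₂ β' n' c' p').1 ⟨_, hx'⟩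
  exact ⟨x', huniq _ ((isDefinedBy_elementary j₂ β' n' c' p' x').2 h')⟩

end Lift

theorem IsHOD.isOD {M : Type*} [setLang.Structure M] {x : M} (h : IsHOD x) : IsOD x := by
  obtain ⟨t, -, hx, ht⟩ := h
  exact ht x hx

theorem IsHOD.mem {M : Type*} [setLang.Structure M] {x y : M} (h : IsHOD x) (hy : Mem y x) :
    IsHOD y := by
  obtain ⟨t, htr, hx, ht⟩ := h
  exact ⟨t, htr, htr x hx y hy, ht⟩

/-! ### Transitive classes: absoluteness of ordinals and comparison of HOD. -/

section TransClass

theorem wellFounded_mem (M : Set ZFSet.{u}) : WellFounded (Mem : M → M → Prop) :=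
  InvImage.wf Subtype.val ZFSet.mem_wf

theorem IsTransClass.isOrd_iff {M : Set ZFSet.{u}} (trans : IsTransClass M) (a : M) :
    IsOrd a ↔ (a : ZFSet.{u}).IsOrdinal := by
  constructor
  · rintro ⟨h, h'⟩
    have mem : ∀ y ∈ (a : ZFSet.{u}), y ∈ M := trans a a.2
    refine ⟨fun y hy z hz => ?_, fun {x y z} hxy hyz hz => ?_⟩
    · exact h ⟨y, mem y hy⟩ hy ⟨z, trans y (mem y hy) z hz⟩ hz
    · have hzM := mem z hz
      have hyM := trans z hzM y hyz
      exact h' ⟨z, hzM⟩ hz ⟨y, hyM⟩ hyz ⟨x, trans y hyM x hxy⟩ hxy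
  · intro h
    exact ⟨fun y hy z hz => h.mem_trans hz hy, fun y hy z hz w hw => h.mem_trans' hw hz hy⟩

variable {M₁ M₂ : Set ZFSet.{u}} {N : Type w} [setLang.Structure N]

theorem isOrd_map_mem_range (trans₁ : IsTransClass M₁)
    (sameOrd : ∀ α : ZFSet.{u}, α.IsOrdinal → (α ∈ M₁ ↔ α ∈ M₂))
    (j₁ : M₁ ↪ₑ[setLang] N) (j₂ : M₂ ↪ₑ[setLang] N)
    (agree : ∀ (α : ZFSet.{u}) (h₁ : α ∈ M₁) (h₂ : α ∈ M₂), α.IsOrdinal →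
      j₁ ⟨α, h₁⟩ = j₂ ⟨α, h₂⟩) (a : M₁) (ha : IsOrd a) : j₁ a ∈ Set.range j₂ := by
  have h := (trans₁.isOrd_iff a).1 ha
  have h₂ := (sameOrd a h).1 a.2
  exact ⟨⟨a, h₂⟩, (agree a a.2 h₂ h).symm⟩

/-- A member `y` of `x` is again hereditarily ordinal definable, so `j₁ y = j₂ y'` for some `y'`.
The common image of `x` and `x'` gives `y' ∈ x'`, and induction gives `y = y'`; the converse
inclusion is symmetric. -/
theorem IsHOD.val_eq_of_map_eq (trans₁ : IsTransClass M₁) (trans₂ : IsTransClass M₂)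
    (j₁ : M₁ ↪ₑ[setLang] N) (j₂ : M₂ ↪ₑ[setLang] N)
    (lift₁ : ∀ x : M₁, IsHOD x → j₁ x ∈ Set.range j₂)
    (lift₂ : ∀ x : M₂, IsHOD x → j₂ x ∈ Set.range j₁) {x : M₁} {x' : M₂}
    (hx : IsHOD x) (hx' : IsHOD x') (h : j₁ x = j₂ x') : (x : ZFSet.{u}) = x' := by
  induction x using (wellFounded_mem M₁).induction generalizing x' with
  | _ x ih =>
    ext z
    constructor
    · intro hz
      let y : M₁ := ⟨z, trans₁ x x.2 z hz⟩
      have hy : Mem y x := hz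
      obtain ⟨y', hy'⟩ := lift₁ y (hx.mem hy)
      have hmem : Mem y' x' := by
        rwa [← mem_elementary j₂, hy', ← h, mem_elementary j₁]
      have : z = y' := ih y hy (hx.mem hy) (hx'.mem hmem) hy'.symm
      rw [this]
      exact hmem
    · intro hz
      let y' : M₂ := ⟨z, trans₂ x' x'.2 z hz⟩
      have hy' : Mem y' x' := hz
      obtain ⟨y, hy⟩ := lift₂ y' (hx'.mem hy')
      have hmem : Mem y x := by
        rwa [← mem_elementary j₁, hy, h, mem_elementary j₂]
      have : (y : ZFSet.{u}) = z := ih y hmem (hx.mem hmem) (hx'.mem hy') hy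
      rw [← this]
      exact hmem

theorem HOD_exists_map_eq (trans₁ : IsTransClass M₁) (trans₂ : IsTransClass M₂)
    (j₁ : M₁ ↪ₑ[setLang] N) (j₂ : M₂ ↪ₑ[setLang] N)
    (lift₁ : ∀ x : M₁, IsHOD x → j₁ x ∈ Set.range j₂)
    (lift₂ : ∀ x : M₂, IsHOD x → j₂ x ∈ Set.range j₁) {x : ZFSet.{u}} (hx : x ∈ HOD M₁) :
    x ∈ HOD M₂ ∧ ∀ (h₁ : x ∈ M₁) (h₂ : x ∈ M₂), j₁ ⟨x, h₁⟩ = j₂ ⟨x, h₂⟩ := by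
  obtain ⟨hxM, hx⟩ := hx
  obtain ⟨x', hj⟩ := lift₁ _ hx
  -- Hereditary ordinal definability passes from `x` up to the common image in `N` and down to `x'`.
  have hx' : IsHOD x' := by rwa [← isHOD_elementary j₂, hj, isHOD_elementary j₁]
  obtain rfl : x = x' := hx.val_eq_of_map_eq trans₁ trans₂ j₁ j₂ lift₁ lift₂ hx' hj.symm
  exact ⟨⟨x'.2, hx'⟩, fun _ _ => hj.symm⟩

end TransClass

end SetModel

theorem mainTheorem4
    (M₁ M₂ : Set ZFSet.{u}) (N : Type w) [SetModel.setLang.Structure N]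
    (trans₁ : SetModel.IsTransClass M₁) (trans₂ : SetModel.IsTransClass M₂)
    (zf₁ : SetModel.IsModelZF M₁) (zf₂ : SetModel.IsModelZF M₂) (zfN : SetModel.IsModelZF N)
    (sameOrd : ∀ α : ZFSet.{u}, α.IsOrdinal → (α ∈ M₁ ↔ α ∈ M₂))
    (j₁ : M₁ ↪ₑ[SetModel.setLang] N) (j₂ : M₂ ↪ₑ[SetModel.setLang] N)
    (agree : ∀ (α : ZFSet.{u}) (h₁ : α ∈ M₁) (h₂ : α ∈ M₂), α.IsOrdinal →
      j₁ ⟨α, h₁⟩ = j₂ ⟨α, h₂⟩) :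
    SetModel.HOD M₁ = SetModel.HOD M₂ ∧
      ∀ (x : ZFSet.{u}) (h₁ : x ∈ M₁) (h₂ : x ∈ M₂), x ∈ SetModel.HOD M₁ →
        j₁ ⟨x, h₁⟩ = j₂ ⟨x, h₂⟩ := by
  have lift₁ : ∀ x : M₁, SetModel.IsHOD x → j₁ x ∈ Set.range j₂ := fun x hx =>
    hx.isOD.map_mem_range zfN.extensionality
      (SetModel.isOrd_map_mem_range trans₁ sameOrd j₁ j₂ agree) (SetModel.wellFounded_mem M₁) zf₁
  have lift₂ : ∀ x : M₂, SetModel.IsHOD x → j₂ x ∈ Set.range j₁ := fun x hx =>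
    hx.isOD.map_mem_range zfN.extensionality
      (SetModel.isOrd_map_mem_range trans₂ (fun α hα => (sameOrd α hα).symm) j₂ j₁
        fun α h₂ h₁ hα => (agree α h₁ h₂ hα).symm) (SetModel.wellFounded_mem M₂) zf₂
  have key₁ := fun x (hx : x ∈ SetModel.HOD M₁) =>
    SetModel.HOD_exists_map_eq trans₁ trans₂ j₁ j₂ lift₁ lift₂ hx
  have key₂ := fun x (hx : x ∈ SetModel.HOD M₂) =>
    SetModel.HOD_exists_map_eq trans₂ trans₁ j₂ j₁ lift₂ lift₁ hx
  exact ⟨Set.Subset.antisymm (fun x hx => (key₁ x hx).1) fun x hx => (key₂ x hx).1,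
    fun x h₁ h₂ hx => (key₁ x hx).2 h₁ h₂⟩
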